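/- Let $\mathsf R,\mathsf C\ge 1$ be integers and let $W\in\mathbb R^{\mathsf R\times\mathsf C}$ have non-negative entries (a base matrix). Suppose that there are constants $\xi_1,\xi_2>0$ with $\xi_1\le\frac1{\mathsf R}\sum_{r'}W_{r'c}\le\xi_2$ and $\xi_1\le\frac1{\mathsf C}\sum_{c'}W_{rc'}\le\xi_2$ for all $r\in[\mathsf R]$, $c\in[\mathsf C]$. Fix $\sigma>0$, a rate $R>0$ (in nats) and an integer $K\ge1$, and let $p_k=e^{2\pi i k/K}$, $k=1,\dots,K$. For $M\ge 2$ and $\tau>0$ let $$\mathcal E_M(\tau)=\mathbb E\left[\frac{\sum_{k=1}^{K}\Re[p_k]\,e^{\frac1\tau\Re[(1+\sqrt\tau U_1)\overline{p_k}]}}{\sum_{a=1}^{K}e^{\frac1\tau\Re[(1+\sqrt\tau U_1)\overline{p_a}]}+\sum_{j=2}^{M}\sum_{b=1}^{K}e^{\Re[U_j\overline{p_b}]/\sqrt\tau}}\right],$$ where $U_1,\dots,U_M$ are i.i.d. $\mathcal{CN}(0,2)$, that is, their real and imaginary parts are independent standard Gaussians. The state evolution with parameters $(K,M)$ is the recursion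 $\psi_c^0=1$ and, for $t\ge0$, $$\phi_r^t=\sigma^2+\frac1{\mathsf C}\sum_{c}W_{rc}\psi_c^t,\qquad \tau_c^t=\frac{R/2}{\ln(KM)}\Big[\frac1{\mathsf R}\sum_r\frac{W_{rc}}{\phi_r^t}\Big]^{-1},\qquad \psi_c^{t+1}=1-\mathcal E_M(\tau_c^t).$$ The asymptotic state evolution, which does not depend on $K$, is the recursion $\bar\psi_c^0=1$ and, for $t\ge0$, $$\bar\phi_r^t=\sigma^2+\frac1{\mathsf C}\sum_cW_{rc}\bar\psi_c^t,\qquad \bar\psi_c^{t+1}=1-\mathbb 1\Big\{\frac1{\mathsf R}\sum_r\frac{W_{rc}}{\bar\phi_r^t}>R\Big\}.$$ Call the column block $c$ critical at iteration $t$ if $\frac1{\mathsf R}\sum_r W_{rc}/\bar\phi_r^t=R$. Let $t\ge0$ be such that no column block is critical at any iteration $s<t$. Then, as $M\to\infty$ with $W,\sigma,R,K$ fixed, $\psi_c^t\to\bar\psi_c^t$ for all $c\in[\mathsf C]$ and $\phi_r^t\to\bar\phi_r^t$ for all $r\in[\mathsf R]$; moreover $\psi_c^{t+1}\to\bar\psi_c^{t+1}$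 for every column block $c$ that is not critical at iteration $t$. In particular, if no column block is ever critical, the state evolution converges to the asymptotic state evolution at every iteration. -/

import Mathlib

open MeasureTheory ProbabilityTheory Filter Topology
open scoped NNReal ComplexConjugate

noncomputable section

namespace ModSparc

/-- The circularly symmetric complex Gaussian law `CN(0, v)`: the real and imaginary parts are
independent real Gaussians of mean `0` and variance `v / 2`. -/
def complexGaussian (v : ℝ≥0) : Measure ℂ :=
  ((gaussianReal 0 (v / 2)).prod (gaussianReal 0 (v / 2))).map
    (fun p : ℝ × ℝ => (⟨p.1, p.2⟩ : ℂ))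

/-- The `k`-th symbol `exp (2 π i k / K)` of the `K`-ary PSK constellation. -/
def psk (K k : ℕ) : ℂ :=
  Complex.exp (Complex.I * (2 * Real.pi * k / K))

/-- The random ratio inside the expectation that defines `𝓔(τ)`. The variable `u` is `U₁`, and
`v` lists the remaining `M - 1` variables `U₂, …, U_M`. -/
def seRatio (K M : ℕ) (τ : ℝ) (u : ℂ) (v : Fin (M - 1) → ℂ) : ℝ :=
  (∑ k ∈ Finset.Icc 1 K,
      (psk K k).re * Real.exp (1 / τ * ((1 + Real.sqrt τ * u) * conj (psk K k)).re)) /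
    (∑ a ∈ Finset.Icc 1 K,
        Real.exp (1 / τ * ((1 + Real.sqrt τ * u) * conj (psk K a)).re)
      + ∑ j : Fin (M - 1), ∑ b ∈ Finset.Icc 1 K,
        Real.exp ((v j * conj (psk K b)).re / Real.sqrt τ))

/-- `𝓔(τ)`: the expectation of the ratio for `U₁, …, U_M` i.i.d. `CN(0, 2)`. -/
def seE (K M : ℕ) (τ : ℝ) : ℝ :=
  ∫ p : ℂ × (Fin (M - 1) → ℂ), seRatio K M τ p.1 p.2
    ∂((complexGaussian 2).prod (Measure.pi fun _ : Fin (M - 1) => complexGaussian 2))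

/-- The residual variance `φ_r = σ² + (1/C) ∑_c W_{rc} ψ_c` of row block `r`. -/
def rowVar {nR nC : ℕ} (W : Matrix (Fin nR) (Fin nC) ℝ) (σ : ℝ) (ψ : Fin nC → ℝ)
    (r : Fin nR) : ℝ :=
  σ ^ 2 + 1 / (nC : ℝ) * ∑ c, W r c * ψ c

/-- The quantity `(1/R) ∑_r W_{rc} / φ_r` of column block `c`, where `R` is the number of rows of
the base matrix. -/
def colSnr {nR nC : ℕ} (W : Matrix (Fin nR) (Fin nC) ℝ) (φ : Fin nR → ℝ) (c : Fin nC) : ℝ :=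
  1 / (nR : ℝ) * ∑ r, W r c / φ r

/-- The effective noise variance `τ_c = (R / 2) / ln (K M) * [(1/R) ∑_r W_{rc} / φ_r]⁻¹`, where
the first `R`, here `rate`, is the rate of the code in nats. -/
def effNoise {nR nC : ℕ} (W : Matrix (Fin nR) (Fin nC) ℝ) (rate : ℝ) (K M : ℕ)
    (φ : Fin nR → ℝ) (c : Fin nC) : ℝ :=
  (rate / 2) / Real.log ((K : ℝ) * M) * (colSnr W φ c)⁻¹

/-- State evolution: `ψ_c^t` for `K`-ary PSK and section size `M`. -/
def sePsi {nR nC : ℕ} (W : Matrix (Fin nR) (Fin nC) ℝ) (σ rate : ℝ) (K M : ℕ) :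
    ℕ → Fin nC → ℝ
  | 0 => fun _ => 1
  | t + 1 => fun c =>
      1 - seE K M (effNoise W rate K M (rowVar W σ (sePsi W σ rate K M t)) c)

/-- State evolution: `φ_r^t` for `K`-ary PSK and section size `M`. -/
def sePhi {nR nC : ℕ} (W : Matrix (Fin nR) (Fin nC) ℝ) (σ rate : ℝ) (K M : ℕ) (t : ℕ) :
    Fin nR → ℝ :=
  rowVar W σ (sePsi W σ rate K M t)

/-- The asymptotic recursion for `ψ̄_c^t`; it involves neither `K` nor `M`. -/
def asympPsi {nR nC : ℕ} (W : Matrix (Fin nR) (Fin nC) ℝ) (σ rate : ℝ) :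
    ℕ → Fin nC → ℝ
  | 0 => fun _ => 1
  | t + 1 => fun c =>
      1 - if colSnr W (rowVar W σ (asympPsi W σ rate t)) c > rate then 1 else 0

/-- The asymptotic values `φ̄_r^t`. -/
def asympPhi {nR nC : ℕ} (W : Matrix (Fin nR) (Fin nC) ℝ) (σ rate : ℝ) (t : ℕ) :
    Fin nR → ℝ :=
  rowVar W σ (asympPsi W σ rate t)

end ModSparc

end

/-!
The function `𝓔` has a sharp threshold. Put `s = 1 / √τ` and let `τ → 0` with `τ ln (K M) → κ`.
The ratio inside `𝓔(τ)` is the real part of a posterior mean of the symbol at the true position,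
where the symbol `1` was sent: that symbol has weight `exp (s² + s Re U₁)`, the other symbols at the true position
have weight `exp (s² Re p_k + O(s))` with `Re p_k < 1`, and the wrong positions have total weight
`N = ∑_j ∑_b exp (s Re (U_j conj p_b))`. For fixed `U₁` everything is decided by comparing `N`
with `exp s²` on the exponential scale `s²`.

* If `κ < 1 / 2`, then `𝔼 N = (M - 1) K exp (s² / 2)`, which is at most
  `exp ((κ + 1 / 2 + o(1)) s²)`, so `N` is negligible and `𝓔(τ) → 1` (`tendsto_seE_one`).
* If `κ > 1 / 2`, then the largest of the `M - 1` standard Gaussians `Re U_j` exceeds `θ s` with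
  high probability whenever `θ < √(2 κ)`. As some such `θ` exceeds `1`, the sum `N` dominates and
  `𝓔(τ) → 0` (`tendsto_seE_zero`).

Since the ratio is bounded by `1`, dominated convergence in `U₁` passes from fixed `U₁` to `𝓔`
(`tendsto_seE_of_forall`). For `τ = effNoise` one has `τ ln (K M) = rate / (2 S)` with `S` the value
of `colSnr`, so `κ < 1 / 2` means `S > rate` (`tendsto_one_sub_seE`). The theorem follows by
induction on the iteration, because `rowVar` and `colSnr` are continuous in their arguments at the
asymptotic values, where `φ̄_r ≥ σ² > 0`.
-/

namespace ModSparc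

/-! ### The constellation -/

lemma psk_eq (K k : ℕ) : psk K k = Complex.exp ((2 * Real.pi * k / K : ℝ) * Complex.I) := by
  unfold psk
  congr 1
  push_cast
  ring

lemma norm_psk (K k : ℕ) : ‖psk K k‖ = 1 := by
  rw [psk_eq, Complex.norm_exp_ofReal_mul_I]

lemma psk_self {K : ℕ} (hK : 1 ≤ K) : psk K K = 1 := by
  have : (K : ℂ) ≠ 0 := by exact_mod_cast (by lia : K ≠ 0)
  unfold psk
  rw [mul_div_assoc, div_self this, mul_one, mul_comm, Complex.exp_two_pi_mul_I]

lemma abs_re_psk_le (K k : ℕ) : |(psk K k).re| ≤ 1 :=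
  (Complex.abs_re_le_norm _).trans (norm_psk K k).le

lemma re_mul_conj_psk_le (K k : ℕ) (u : ℂ) : |(u * conj (psk K k)).re| ≤ ‖u‖ := by
  refine (Complex.abs_re_le_norm _).trans ?_
  rw [norm_mul, RCLike.norm_conj, norm_psk, mul_one]

/-! ### Bounds on the ratio -/

/-- The unnormalised posterior weight of the symbol `psk K k` at the true position of a section,
when the symbol `1` was sent there; `u` is the noise at that position. -/
noncomputable def signalWeight (K : ℕ) (τ : ℝ) (u : ℂ) (k : ℕ) : ℝ :=
  Real.exp (1 / τ * ((1 + Real.sqrt τ * u) * conj (psk K k)).re)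

/-- The total unnormalised posterior weight of the wrong positions of a section, whose noise
variables are listed by `v`. -/
noncomputable def noiseWeight (K M : ℕ) (τ : ℝ) (v : Fin (M - 1) → ℂ) : ℝ :=
  ∑ j : Fin (M - 1), ∑ b ∈ Finset.Icc 1 K, Real.exp ((v j * conj (psk K b)).re / Real.sqrt τ)

lemma seRatio_eq (K M : ℕ) (τ : ℝ) (u : ℂ) (v : Fin (M - 1) → ℂ) :
    seRatio K M τ u v = (∑ k ∈ Finset.Icc 1 K, (psk K k).re * signalWeight K τ u k) /
      (∑ k ∈ Finset.Icc 1 K, signalWeight K τ u k + noiseWeight K M τ v) := rfl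

lemma signalWeight_pos (K : ℕ) (τ : ℝ) (u : ℂ) (k : ℕ) : 0 < signalWeight K τ u k :=
  Real.exp_pos _

lemma noiseWeight_nonneg (K M : ℕ) (τ : ℝ) (v : Fin (M - 1) → ℂ) : 0 ≤ noiseWeight K M τ v :=
  Finset.sum_nonneg fun _ _ => Finset.sum_nonneg fun _ _ => (Real.exp_pos _).le

lemma sum_signalWeight_pos {K : ℕ} (hK : 1 ≤ K) (τ : ℝ) (u : ℂ) :
    0 < ∑ k ∈ Finset.Icc 1 K, signalWeight K τ u k :=
  Finset.sum_pos (fun _ _ => signalWeight_pos _ _ _ _) ⟨1, by simp [hK]⟩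

lemma signalWeight_eq {τ : ℝ} (hτ : 0 < τ) (K : ℕ) (u : ℂ) (k : ℕ) :
    signalWeight K τ u k = Real.exp ((psk K k).re * (Real.sqrt τ)⁻¹ ^ 2 +
      (u * conj (psk K k)).re * (Real.sqrt τ)⁻¹) := by
  have h : Real.sqrt τ ≠ 0 := (Real.sqrt_pos.2 hτ).ne'
  have h2 : τ = Real.sqrt τ ^ 2 := (Real.sq_sqrt hτ.le).symm
  have h3 : ((1 + Real.sqrt τ * u) * conj (psk K k)).re =
      (psk K k).re + Real.sqrt τ * (u * conj (psk K k)).re := by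
    rw [add_mul, one_mul, mul_assoc, Complex.add_re, Complex.re_ofReal_mul, Complex.conj_re]
  unfold signalWeight
  rw [h3]
  congr 1
  generalize Real.sqrt τ = x at *
  subst h2
  field_simp

lemma signalWeight_self {τ : ℝ} (hτ : 0 < τ) {K : ℕ} (hK : 1 ≤ K) (u : ℂ) :
    signalWeight K τ u K = Real.exp ((Real.sqrt τ)⁻¹ ^ 2 + u.re * (Real.sqrt τ)⁻¹) := by
  rw [signalWeight_eq hτ, psk_self hK]
  simp

lemma abs_sum_re_psk_mul_le (K : ℕ) (τ : ℝ) (u : ℂ) :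
    |∑ k ∈ Finset.Icc 1 K, (psk K k).re * signalWeight K τ u k| ≤
      ∑ k ∈ Finset.Icc 1 K, signalWeight K τ u k := by
  refine (Finset.abs_sum_le_sum_abs _ _).trans (Finset.sum_le_sum fun k _ => ?_)
  rw [abs_mul, abs_of_pos (signalWeight_pos _ _ _ _)]
  exact mul_le_of_le_one_left (signalWeight_pos _ _ _ _).le (abs_re_psk_le _ _)

lemma abs_seRatio_le_one {K : ℕ} (hK : 1 ≤ K) (M : ℕ) (τ : ℝ) (u : ℂ)
    (v : Fin (M - 1) → ℂ) : |seRatio K M τ u v| ≤ 1 := by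
  have h1 := sum_signalWeight_pos hK τ u
  have h2 := noiseWeight_nonneg K M τ v
  rw [seRatio_eq, abs_div, abs_of_pos (by linarith : 0 < _ + noiseWeight K M τ v)]
  exact div_le_one_of_le₀ ((abs_sum_re_psk_mul_le K τ u).trans (by linarith)) (by linarith)

/-- Comparing the denominator with the weight `signalWeight K τ u K` of the transmitted symbol
bounds the distance of the ratio to `1` by an explicit function of `u` and a multiple of the
noise weight. -/
lemma one_sub_seRatio_le {K : ℕ} (hK : 1 ≤ K) (M : ℕ) {τ : ℝ} (hτ : 0 < τ) (u : ℂ)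
    (v : Fin (M - 1) → ℂ) :
    1 - seRatio K M τ u v ≤
      ∑ k ∈ Finset.Icc 1 K, (1 - (psk K k).re) *
        Real.exp (((psk K k).re - 1) * (Real.sqrt τ)⁻¹ ^ 2 + 2 * ‖u‖ * (Real.sqrt τ)⁻¹) +
      Real.exp (-(Real.sqrt τ)⁻¹ ^ 2 - u.re * (Real.sqrt τ)⁻¹) * noiseWeight K M τ v := by
  have h1 := sum_signalWeight_pos hK τ u
  have h2 := noiseWeight_nonneg K M τ v
  have hs : 0 ≤ (Real.sqrt τ)⁻¹ := by positivity
  have hle : signalWeight K τ u K ≤ ∑ k ∈ Finset.Icc 1 K, signalWeight K τ u k :=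
    Finset.single_le_sum (f := signalWeight K τ u)
      (fun _ _ => (signalWeight_pos _ _ _ _).le) (by simp [hK])
  have heq : 1 - seRatio K M τ u v =
      (∑ k ∈ Finset.Icc 1 K, (1 - (psk K k).re) * signalWeight K τ u k + noiseWeight K M τ v) /
      (∑ k ∈ Finset.Icc 1 K, signalWeight K τ u k + noiseWeight K M τ v) := by
    rw [seRatio_eq, one_sub_div (by linarith)]
    congr 1
    simp only [sub_mul, one_mul, Finset.sum_sub_distrib]
    ring
  have hc (k : ℕ) : 0 ≤ 1 - (psk K k).re := by linarith [(abs_le.1 (abs_re_psk_le K k)).2]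
  rw [heq]
  have hpos := signalWeight_pos K τ u K
  refine (div_le_div_of_nonneg_left (add_nonneg (Finset.sum_nonneg fun k _ =>
    mul_nonneg (hc k) (signalWeight_pos _ _ _ _).le) h2) hpos (by linarith)).trans ?_
  rw [add_div, Finset.sum_div]
  refine add_le_add (Finset.sum_le_sum fun k _ => ?_) ?_
  · rw [mul_div_assoc]
    refine mul_le_mul_of_nonneg_left ?_ (hc k)
    rw [signalWeight_eq hτ, signalWeight_self hτ hK, ← Real.exp_sub, Real.exp_le_exp]
    have h3 := (abs_le.1 (re_mul_conj_psk_le K k u)).2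
    have h4 := (abs_le.1 (Complex.abs_re_le_norm u)).1
    nlinarith
  · rw [signalWeight_self hτ hK, div_eq_mul_inv, ← Real.exp_neg, mul_comm]
    refine le_of_eq ?_
    congr 2
    ring

/-- A single wrong position whose noise `v j` has a large real part makes the ratio small. -/
lemma abs_seRatio_le {K : ℕ} (hK : 1 ≤ K) (M : ℕ) {τ : ℝ} (hτ : 0 < τ) (u : ℂ)
    (v : Fin (M - 1) → ℂ) {y : ℝ} (j : Fin (M - 1)) (hj : y ≤ (v j).re) :
    |seRatio K M τ u v| ≤
      K * Real.exp ((Real.sqrt τ)⁻¹ ^ 2 + ‖u‖ * (Real.sqrt τ)⁻¹ - y * (Real.sqrt τ)⁻¹) := by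
  have h1 := sum_signalWeight_pos hK τ u
  have hs : 0 ≤ (Real.sqrt τ)⁻¹ := by positivity
  have h2 : Real.exp (y * (Real.sqrt τ)⁻¹) ≤ noiseWeight K M τ v := by
    calc Real.exp (y * (Real.sqrt τ)⁻¹)
        ≤ Real.exp ((v j * conj (psk K K)).re / Real.sqrt τ) := by
          rw [psk_self hK, map_one, mul_one, div_eq_mul_inv, Real.exp_le_exp]
          exact mul_le_mul_of_nonneg_right hj hs
      _ ≤ ∑ b ∈ Finset.Icc 1 K, Real.exp ((v j * conj (psk K b)).re / Real.sqrt τ) :=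
          Finset.single_le_sum (f := fun b => Real.exp ((v j * conj (psk K b)).re / Real.sqrt τ))
            (fun _ _ => (Real.exp_pos _).le) (by simp [hK])
      _ ≤ noiseWeight K M τ v :=
          Finset.single_le_sum (f := fun i => ∑ b ∈ Finset.Icc 1 K,
              Real.exp ((v i * conj (psk K b)).re / Real.sqrt τ))
            (fun _ _ => Finset.sum_nonneg fun _ _ => (Real.exp_pos _).le) (Finset.mem_univ j)
  have h3 : ∑ k ∈ Finset.Icc 1 K, signalWeight K τ u k ≤
      K * Real.exp ((Real.sqrt τ)⁻¹ ^ 2 + ‖u‖ * (Real.sqrt τ)⁻¹) := by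
    have : ∀ k ∈ Finset.Icc 1 K, signalWeight K τ u k ≤
        Real.exp ((Real.sqrt τ)⁻¹ ^ 2 + ‖u‖ * (Real.sqrt τ)⁻¹) := fun k _ => by
      rw [signalWeight_eq hτ, Real.exp_le_exp]
      have h3 := (abs_le.1 (re_mul_conj_psk_le K k u)).2
      have h4 := (abs_le.1 (abs_re_psk_le K k)).2
      nlinarith [sq_nonneg (Real.sqrt τ)⁻¹]
    simpa using Finset.sum_le_card_nsmul _ _ _ this
  have hy := Real.exp_pos (y * (Real.sqrt τ)⁻¹)
  rw [seRatio_eq, abs_div, abs_of_pos (by linarith : 0 < _ + noiseWeight K M τ v), Real.exp_sub,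
    ← mul_div_assoc]
  exact div_le_div₀ (by positivity) ((abs_sum_re_psk_mul_le K τ u).trans h3) hy (by linarith)

/-! ### Gaussian estimates -/

instance isProbabilityMeasure_complexGaussian (v : ℝ≥0) :
    IsProbabilityMeasure (complexGaussian v) :=
  Measure.isProbabilityMeasure_map Complex.measurableEquivRealProd.symm.measurable.aemeasurable

lemma complexGaussian_two : complexGaussian 2 =
    ((gaussianReal 0 1).prod (gaussianReal 0 1)).map Complex.measurableEquivRealProd.symm := by
  have : (2 : ℝ≥0) / 2 = 1 := by norm_num
  unfold complexGaussian
  rw [this]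
  rfl

lemma map_re_complexGaussian_two :
    (complexGaussian 2).map Complex.re = gaussianReal 0 1 := by
  rw [complexGaussian_two, Measure.map_map Complex.measurable_re (MeasurableEquiv.measurable _)]
  exact (measurePreserving_fst (μ := gaussianReal 0 1) (ν := gaussianReal 0 1)).map_eq

/-- The moment generating function of the real part of a rotated `CN(0, 2)` variable, which is a
standard Gaussian. -/
lemma integrable_and_integral_exp_complexGaussian (s : ℝ) {p : ℂ} (hp : ‖p‖ = 1) :
    Integrable (fun z : ℂ => Real.exp (s * (z * conj p).re)) (complexGaussian 2) ∧
    ∫ z : ℂ, Real.exp (s * (z * conj p).re) ∂(complexGaussian 2) = Real.exp (s ^ 2 / 2) := by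
  have hfun : ((fun z : ℂ => Real.exp (s * (z * conj p).re)) ∘
      Complex.measurableEquivRealProd.symm) =
      fun q : ℝ × ℝ => Real.exp (s * p.re * q.1) * Real.exp (s * p.im * q.2) := by
    funext q
    rw [← Real.exp_add]
    simp [Complex.measurableEquivRealProd_symm_apply]
    ring
  have hmgf (t : ℝ) : ∫ x, Real.exp (t * x) ∂(gaussianReal 0 1) = Real.exp (t ^ 2 / 2) := by
    have := congrFun (mgf_id_gaussianReal (μ := 0) (v := 1)) t
    simpa [mgf] using this
  have hp2 : p.re ^ 2 + p.im ^ 2 = 1 := by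
    have := Complex.sq_norm p
    rw [hp, Complex.normSq_apply] at this
    linarith
  rw [complexGaussian_two]
  constructor
  · rw [integrable_map_equiv, hfun]
    exact (integrable_exp_mul_gaussianReal _).mul_prod (integrable_exp_mul_gaussianReal _)
  · rw [integral_map_equiv]
    have := congrArg (fun f => ∫ q, f q ∂((gaussianReal 0 1).prod (gaussianReal 0 1))) hfun
    simp only [Function.comp] at this
    rw [this, integral_prod_mul (fun x => Real.exp (s * p.re * x))
      (fun x => Real.exp (s * p.im * x)), hmgf, hmgf, ← Real.exp_add]
    congr 1
    linear_combination s ^ 2 / 2 * hp2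

lemma integrable_and_integral_noiseWeight (K M : ℕ) (τ : ℝ) :
    Integrable (noiseWeight K M τ) (Measure.pi fun _ : Fin (M - 1) => complexGaussian 2) ∧
    ∫ v, noiseWeight K M τ v ∂(Measure.pi fun _ : Fin (M - 1) => complexGaussian 2) =
      (M - 1 : ℕ) * (K * Real.exp ((Real.sqrt τ)⁻¹ ^ 2 / 2)) := by
  have hE (b : ℕ) := integrable_and_integral_exp_complexGaussian (Real.sqrt τ)⁻¹ (norm_psk K b)
  have hmp (j : Fin (M - 1)) :=
    measurePreserving_eval (fun _ : Fin (M - 1) => complexGaussian 2) j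
  have hterm (j : Fin (M - 1)) (b : ℕ) :
      Integrable (fun v : Fin (M - 1) → ℂ => Real.exp ((v j * conj (psk K b)).re / Real.sqrt τ))
        (Measure.pi fun _ : Fin (M - 1) => complexGaussian 2) ∧
      ∫ v : Fin (M - 1) → ℂ, Real.exp ((v j * conj (psk K b)).re / Real.sqrt τ)
        ∂(Measure.pi fun _ : Fin (M - 1) => complexGaussian 2) =
        Real.exp ((Real.sqrt τ)⁻¹ ^ 2 / 2) := by
    simp only [div_eq_inv_mul _ (Real.sqrt τ)]
    refine ⟨(hmp j).integrable_comp_of_integrable (hE b).1, ?_⟩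
    have hmap := integral_map (hmp j).measurable.aemeasurable
      (f := fun z => Real.exp ((Real.sqrt τ)⁻¹ * (z * conj (psk K b)).re))
      (by rw [(hmp j).map_eq]; exact (hE b).1.aestronglyMeasurable)
    rw [(hmp j).map_eq, (hE b).2] at hmap
    exact hmap.symm
  unfold noiseWeight
  constructor
  · exact integrable_finsetSum _ fun j _ => integrable_finsetSum _ fun b _ => (hterm j b).1
  · rw [integral_finsetSum _ fun j _ => integrable_finsetSum _ fun b _ => (hterm j b).1]
    simp_rw [integral_finsetSum _ fun b _ => (hterm _ b).1, (hterm _ _).2]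
    simp

/-- A crude lower bound on the Gaussian tail: the smallest value of the density on `[y, y + 1]`. -/
lemma exp_le_gaussianReal_Ici {y : ℝ} (hy : 0 ≤ y) :
    (Real.sqrt (2 * Real.pi))⁻¹ * Real.exp (-(y + 1) ^ 2 / 2) ≤
      (gaussianReal 0 1).real (Set.Ici y) := by
  have h1 : (gaussianReal 0 1).real (Set.Icc y (y + 1)) ≤ (gaussianReal 0 1).real (Set.Ici y) :=
    measureReal_mono Set.Icc_subset_Ici_self
  refine le_trans ?_ h1
  rw [measureReal_def, gaussianReal_apply_eq_integral 0 one_ne_zero,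
    ENNReal.toReal_ofReal (integral_nonneg fun x => gaussianPDFReal_nonneg _ _ _)]
  have h2 : ∫ x in Set.Icc y (y + 1), (Real.sqrt (2 * Real.pi))⁻¹ * Real.exp (-(y + 1) ^ 2 / 2) =
      (Real.sqrt (2 * Real.pi))⁻¹ * Real.exp (-(y + 1) ^ 2 / 2) := by simp
  rw [← h2]
  refine setIntegral_mono_on (integrableOn_const (by simp)) (integrable_gaussianPDFReal 0 1).integrableOn
    measurableSet_Icc fun x hx => ?_
  unfold gaussianPDFReal
  simp only [NNReal.coe_one, mul_one, sub_zero]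
  gcongr
  · linarith [hx.1]
  · exact hx.2

lemma pi_real_forall_re_lt_le (n : ℕ) {y : ℝ} (hy : 0 ≤ y) :
    (Measure.pi fun _ : Fin n => complexGaussian 2).real {v | ∀ j, (v j).re < y} ≤
      Real.exp (-(n * ((Real.sqrt (2 * Real.pi))⁻¹ * Real.exp (-(y + 1) ^ 2 / 2)))) := by
  have hset : {v : Fin n → ℂ | ∀ j, (v j).re < y} =
      Set.univ.pi fun _ => Complex.re ⁻¹' Set.Iio y := by ext; simp
  have hre : (complexGaussian 2).real (Complex.re ⁻¹' Set.Iio y) =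
      1 - (gaussianReal 0 1).real (Set.Ici y) := by
    rw [← map_measureReal_apply Complex.measurable_re measurableSet_Iio,
      map_re_complexGaussian_two, ← Set.compl_Ici, probReal_compl_eq_one_sub measurableSet_Ici]
  rw [hset, measureReal_def, Measure.pi_pi, Finset.prod_const, ENNReal.toReal_pow,
    ← measureReal_def, hre, Finset.card_univ, Fintype.card_fin, ← mul_neg, Real.exp_nat_mul]
  refine pow_le_pow_left₀ (sub_nonneg.2 measureReal_le_one) ?_ _
  have := exp_le_gaussianReal_Ici hy
  exact (by linarith : _ ≤ _).trans (Real.one_sub_le_exp_neg _)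

/-! ### The threshold of `𝓔` -/

lemma measurable_seRatio (K M : ℕ) (τ : ℝ) :
    Measurable fun p : ℂ × (Fin (M - 1) → ℂ) => seRatio K M τ p.1 p.2 := by
  unfold seRatio
  fun_prop

lemma seE_eq_integral_integral {K : ℕ} (hK : 1 ≤ K) (M : ℕ) (τ : ℝ) :
    seE K M τ = ∫ u, ∫ v, seRatio K M τ u v
      ∂(Measure.pi fun _ : Fin (M - 1) => complexGaussian 2) ∂(complexGaussian 2) :=
  integral_prod _ (Integrable.of_bound (measurable_seRatio K M τ).aestronglyMeasurable 1
    (ae_of_all _ fun p => abs_seRatio_le_one hK M τ p.1 p.2))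

lemma integrable_seRatio {K : ℕ} (hK : 1 ≤ K) (M : ℕ) (τ : ℝ) (u : ℂ) :
    Integrable (seRatio K M τ u) (Measure.pi fun _ : Fin (M - 1) => complexGaussian 2) :=
  Integrable.of_bound
    ((measurable_seRatio K M τ).comp measurable_prodMk_left).aestronglyMeasurable 1
    (ae_of_all _ fun v => abs_seRatio_le_one hK M τ u v)

/-- Dominated convergence in `u`: it suffices to average over the other variables first. -/
lemma tendsto_seE_of_forall {K : ℕ} (hK : 1 ≤ K) {τ : ℕ → ℝ} {l : ℝ}
    (h : ∀ u, Tendsto (fun M : ℕ => ∫ v, seRatio K M (τ M) u v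
      ∂(Measure.pi fun _ : Fin (M - 1) => complexGaussian 2)) atTop (𝓝 l)) :
    Tendsto (fun M : ℕ => seE K M (τ M)) atTop (𝓝 l) := by
  simp_rw [seE_eq_integral_integral hK]
  have : l = ∫ _ : ℂ, l ∂(complexGaussian 2) := by simp
  rw [this]
  refine tendsto_integral_filter_of_dominated_convergence (fun _ => 1)
    (Eventually.of_forall fun M => ?_) (Eventually.of_forall fun M => ae_of_all _ fun u => ?_)
    (integrable_const _) (ae_of_all _ h)
  · exact ((measurable_seRatio K M (τ M)).stronglyMeasurable.integral_prod_right').aestronglyMeasurable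
  · refine (norm_integral_le_of_norm_le_const
      (ae_of_all _ fun v => abs_seRatio_le_one hK M (τ M) u v)).trans ?_
    simp

lemma tendsto_exp_quadratic {s b : ℕ → ℝ} {b₀ : ℝ} (hs : Tendsto s atTop atTop)
    (hb : Tendsto b atTop (𝓝 b₀)) (hb₀ : b₀ < 0) (c : ℝ) :
    Tendsto (fun M => Real.exp (b M * s M ^ 2 + c * s M)) atTop (𝓝 0) := by
  refine Real.tendsto_exp_atBot.comp ?_
  have : (fun M => b M * s M ^ 2 + c * s M) = fun M => s M * (b M * s M + c) := by
    funext M; ring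
  rw [this]
  exact hs.atTop_mul_atBot₀ (tendsto_atBot_add_const_right _ _ (hb.neg_mul_atTop hb₀ hs))

lemma tendsto_inv_sqrt_atTop {τ : ℕ → ℝ} (hτ : ∀ᶠ M in atTop, 0 < τ M)
    (hτ0 : Tendsto τ atTop (𝓝 0)) : Tendsto (fun M => (Real.sqrt (τ M))⁻¹) atTop atTop := by
  refine tendsto_inv_nhdsGT_zero.comp (tendsto_nhdsWithin_iff.2 ⟨?_, ?_⟩)
  · simpa [Function.comp_def] using (Real.continuous_sqrt.tendsto 0).comp hτ0
  · filter_upwards [hτ] with M hM using Real.sqrt_pos.2 hM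

/-- The number `K M` of positions on the exponential scale `s²`, where `s = 1 / √τ`. -/
lemma natCast_mul_eq_exp {K M : ℕ} (hK : 1 ≤ K) (hM : 1 ≤ M) {τ : ℝ} (hτ : 0 < τ) :
    (K : ℝ) * M = Real.exp (τ * Real.log (K * M) * (Real.sqrt τ)⁻¹ ^ 2) := by
  have : (0 : ℝ) < K * M := by positivity
  rw [inv_pow, Real.sq_sqrt hτ.le, mul_comm τ, mul_assoc, mul_inv_cancel₀ hτ.ne', mul_one,
    Real.exp_log this]

/-- Below the threshold the posterior concentrates on the transmitted symbol: given `u`, the mean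
`(M - 1) K exp (1 / (2 τ))` of the noise weight is negligible against the weight
`exp (1 / τ + u.re / √τ)` of the truth. -/
lemma tendsto_seE_one {K : ℕ} (hK : 1 ≤ K) {τ : ℕ → ℝ} {κ : ℝ}
    (hτ : ∀ᶠ M in atTop, 0 < τ M) (hτ0 : Tendsto τ atTop (𝓝 0))
    (hκ : Tendsto (fun M : ℕ => τ M * Real.log ((K : ℝ) * M)) atTop (𝓝 κ)) (hκ2 : κ < 1 / 2) :
    Tendsto (fun M : ℕ => seE K M (τ M)) atTop (𝓝 1) := by
  refine tendsto_seE_of_forall hK fun u => ?_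
  have hs := tendsto_inv_sqrt_atTop hτ hτ0
  set s := fun M => (Real.sqrt (τ M))⁻¹ with hsdef
  have hlim : Tendsto (fun M : ℕ => ∑ k ∈ Finset.Icc 1 K, (1 - (psk K k).re) *
        Real.exp (((psk K k).re - 1) * s M ^ 2 + 2 * ‖u‖ * s M) +
      Real.exp ((τ M * Real.log ((K : ℝ) * M) - 1 / 2) * s M ^ 2 + (-u.re) * s M))
      atTop (𝓝 (∑ k ∈ Finset.Icc 1 K, 0 + 0)) := by
    refine (tendsto_finsetSum _ fun k _ => ?_).add
      (tendsto_exp_quadratic hs (hκ.sub_const _) (by linarith) _)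
    -- The exponential does not decay for `psk K k = 1`, but there its coefficient vanishes.
    rcases ((abs_le.1 (abs_re_psk_le K k)).2).eq_or_lt with h | h
    · simp [h]
    · simpa using (tendsto_exp_quadratic hs (tendsto_const_nhds (x := (psk K k).re - 1))
        (by linarith) (2 * ‖u‖)).const_mul (1 - (psk K k).re)
  simp only [Finset.sum_const_zero, add_zero] at hlim
  have hlow : Tendsto (fun M : ℕ => 1 - (∑ k ∈ Finset.Icc 1 K, (1 - (psk K k).re) *
        Real.exp (((psk K k).re - 1) * s M ^ 2 + 2 * ‖u‖ * s M) +
      Real.exp ((τ M * Real.log ((K : ℝ) * M) - 1 / 2) * s M ^ 2 + (-u.re) * s M)))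
      atTop (𝓝 1) := by simpa using hlim.const_sub 1
  refine tendsto_of_tendsto_of_tendsto_of_le_of_le' hlow tendsto_const_nhds ?_
    (Eventually.of_forall fun M => ?_)
  · filter_upwards [hτ, eventually_ge_atTop 1] with M hM hM1
    obtain ⟨hNi, hN⟩ := integrable_and_integral_noiseWeight K M (τ M)
    have hint := integral_mono ((integrable_const 1).sub (integrable_seRatio hK M (τ M) u))
      ((integrable_const _).add (hNi.const_mul _)) (one_sub_seRatio_le hK M hM u)
    simp only [Pi.add_apply, Pi.sub_apply] at hint
    rw [integral_sub (integrable_const _) (integrable_seRatio hK M (τ M) u),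
      integral_add (integrable_const _) (hNi.const_mul _), integral_const_mul, hN] at hint
    simp only [integral_const, probReal_univ, smul_eq_mul, one_mul] at hint
    have hexp : Real.exp (-s M ^ 2 - u.re * s M) *
        ((M - 1 : ℕ) * (K * Real.exp (s M ^ 2 / 2))) ≤
        Real.exp ((τ M * Real.log ((K : ℝ) * M) - 1 / 2) * s M ^ 2 + (-u.re) * s M) := by
      calc _ ≤ Real.exp (-s M ^ 2 - u.re * s M) * (M * (K * Real.exp (s M ^ 2 / 2))) := by
            gcongr
            exact Nat.sub_le _ _
        _ = Real.exp (-s M ^ 2 - u.re * s M) * (K * M * Real.exp (s M ^ 2 / 2)) := by ring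
        _ = _ := by
            rw [natCast_mul_eq_exp hK hM1 hM, ← Real.exp_add, ← Real.exp_add,
              ← natCast_mul_eq_exp hK hM1 hM]
            congr 1
            simp only [hsdef]
            ring
    simp only [hsdef] at hexp ⊢
    linarith
  · refine (integral_mono (integrable_seRatio hK M (τ M) u) (integrable_const 1)
      fun v => (abs_le.1 (abs_seRatio_le_one hK M (τ M) u v)).2).trans ?_
    simp

/-- Splitting according to whether some noise variable reaches the level `y`. -/
lemma abs_integral_seRatio_le {K : ℕ} (hK : 1 ≤ K) (M : ℕ) {τ : ℝ} (hτ : 0 < τ) (u : ℂ) {y : ℝ}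
    (hy : 0 ≤ y) :
    |∫ v, seRatio K M τ u v ∂(Measure.pi fun _ : Fin (M - 1) => complexGaussian 2)| ≤
      K * Real.exp ((Real.sqrt τ)⁻¹ ^ 2 + ‖u‖ * (Real.sqrt τ)⁻¹ - y * (Real.sqrt τ)⁻¹) +
      Real.exp (-((M - 1 : ℕ) *
        ((Real.sqrt (2 * Real.pi))⁻¹ * Real.exp (-(y + 1) ^ 2 / 2)))) := by
  have hA : MeasurableSet {v : Fin (M - 1) → ℂ | ∀ j, (v j).re < y} := by measurability
  have hb (v : Fin (M - 1) → ℂ) : |seRatio K M τ u v| ≤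
      K * Real.exp ((Real.sqrt τ)⁻¹ ^ 2 + ‖u‖ * (Real.sqrt τ)⁻¹ - y * (Real.sqrt τ)⁻¹) +
      {v : Fin (M - 1) → ℂ | ∀ j, (v j).re < y}.indicator (fun _ => (1 : ℝ)) v := by
    by_cases hv : ∀ j, (v j).re < y
    · rw [Set.indicator_of_mem (by exact hv)]
      have := abs_seRatio_le_one hK M τ u v
      have : 0 ≤ K * Real.exp ((Real.sqrt τ)⁻¹ ^ 2 + ‖u‖ * (Real.sqrt τ)⁻¹ -
        y * (Real.sqrt τ)⁻¹) := by positivity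
      linarith
    · rw [Set.indicator_of_notMem (by exact hv), add_zero]
      push Not at hv
      obtain ⟨j, hj⟩ := hv
      exact abs_seRatio_le hK M hτ u v j hj
  have hI : Integrable ({v : Fin (M - 1) → ℂ | ∀ j, (v j).re < y}.indicator
      (fun _ => (1 : ℝ))) (Measure.pi fun _ : Fin (M - 1) => complexGaussian 2) :=
    (integrable_const _).indicator hA
  refine (abs_integral_le_integral_abs).trans ((integral_mono (integrable_seRatio hK M τ u).abs
    ((integrable_const _).add hI) hb).trans ?_)
  simp only [Pi.add_apply]
  rw [integral_add (integrable_const _) hI, integral_indicator_const _ hA]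
  simp only [integral_const, probReal_univ, smul_eq_mul, one_mul, mul_one]
  gcongr
  exact pi_real_forall_re_lt_le _ hy

/-- Above the threshold the posterior misses the true position: for `1 < θ < √(2 κ)` one of the
`M - 1` real parts exceeds `θ / √τ` with high probability, and its weight
`exp (θ / τ)` dominates the weight `exp (1 / τ + O(1 / √τ))` of the truth. -/
lemma tendsto_seE_zero {K : ℕ} (hK : 1 ≤ K) {τ : ℕ → ℝ} {κ : ℝ}
    (hτ : ∀ᶠ M in atTop, 0 < τ M) (hτ0 : Tendsto τ atTop (𝓝 0))
    (hκ : Tendsto (fun M : ℕ => τ M * Real.log ((K : ℝ) * M)) atTop (𝓝 κ)) (hκ2 : 1 / 2 < κ) :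
    Tendsto (fun M : ℕ => seE K M (τ M)) atTop (𝓝 0) := by
  refine tendsto_seE_of_forall hK fun u => ?_
  have hs := tendsto_inv_sqrt_atTop hτ hτ0
  set s := fun M => (Real.sqrt (τ M))⁻¹ with hsdef
  obtain ⟨θ, hθ1, hθ2⟩ : ∃ θ : ℝ, 1 < θ ∧ θ < Real.sqrt (2 * κ) :=
    exists_between (Real.lt_sqrt_of_sq_lt (by linarith))
  have hθκ : θ ^ 2 / 2 < κ := by
    have := (Real.lt_sqrt (by linarith)).1 hθ2
    linarith
  have hmiss : Tendsto (fun M : ℕ => Real.exp (-(((M - 1 : ℕ) : ℝ) *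
      ((Real.sqrt (2 * Real.pi))⁻¹ * Real.exp (-(θ * s M + 1) ^ 2 / 2))))) atTop (𝓝 0) := by
    refine Real.tendsto_exp_neg_atTop_nhds_zero.comp ?_
    have hC : 0 < (2 * K * Real.sqrt (2 * Real.pi))⁻¹ * Real.exp (-1 / 2) := by positivity
    have hgrow : Tendsto (fun M : ℕ => (2 * K * Real.sqrt (2 * Real.pi))⁻¹ * Real.exp (-1 / 2) *
        (Real.exp ((θ ^ 2 / 2 - τ M * Real.log ((K : ℝ) * M)) * s M ^ 2 + θ * s M))⁻¹)
        atTop atTop := by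
      refine Tendsto.const_mul_atTop hC (tendsto_inv_nhdsGT_zero.comp (tendsto_nhdsWithin_iff.2
        ⟨tendsto_exp_quadratic hs (hκ.const_sub _) (by linarith) θ,
          Eventually.of_forall fun M => Real.exp_pos _⟩))
    refine tendsto_atTop_mono' _ ?_ hgrow
    filter_upwards [hτ, eventually_ge_atTop 2] with M hM hM2
    -- In `Fin (M - 1)` the subtraction truncates only at `M = 0`; `M / 2` bounds `M - 1` from below.
    have hhalf : (M : ℝ) / 2 ≤ (M - 1 : ℕ) := by
      have : (2 : ℝ) ≤ M := by exact_mod_cast hM2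
      rw [Nat.cast_sub (by lia)]
      push_cast
      linarith
    have hMe : (M : ℝ) / 2 = (2 * K : ℝ)⁻¹ *
        Real.exp (τ M * Real.log (K * M) * (Real.sqrt (τ M))⁻¹ ^ 2) := by
      rw [← natCast_mul_eq_exp hK (by lia) hM]
      have : (K : ℝ) ≠ 0 := by exact_mod_cast (by lia : K ≠ 0)
      field_simp
    calc _ = (M : ℝ) / 2 * ((Real.sqrt (2 * Real.pi))⁻¹ *
          Real.exp (-(θ * s M + 1) ^ 2 / 2)) := by
          rw [hMe, ← Real.exp_neg, mul_inv]
          have : Real.exp (-1 / 2) * Real.exp (-((θ ^ 2 / 2 - τ M * Real.log ((K : ℝ) * M)) *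
              s M ^ 2 + θ * s M)) = Real.exp (τ M * Real.log (K * M) * (Real.sqrt (τ M))⁻¹ ^ 2) *
              Real.exp (-(θ * s M + 1) ^ 2 / 2) := by
            rw [← Real.exp_add, ← Real.exp_add]
            congr 1
            simp only [hsdef]
            ring
          linear_combination (2 * K : ℝ)⁻¹ * (Real.sqrt (2 * Real.pi))⁻¹ * this
      _ ≤ _ := by gcongr
  have hbound : Tendsto (fun M : ℕ => K * Real.exp ((1 - θ) * s M ^ 2 + ‖u‖ * s M) +
      Real.exp (-(((M - 1 : ℕ) : ℝ) *
      ((Real.sqrt (2 * Real.pi))⁻¹ * Real.exp (-(θ * s M + 1) ^ 2 / 2))))) atTop (𝓝 0) := by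
    simpa using ((tendsto_exp_quadratic hs (tendsto_const_nhds (x := 1 - θ)) (by linarith)
      ‖u‖).const_mul (K : ℝ)).add hmiss
  refine squeeze_zero_norm' ?_ hbound
  filter_upwards [hτ] with M hM
  refine (abs_integral_seRatio_le hK M hM u (y := θ * s M) (by positivity)).trans (le_of_eq ?_)
  simp only [hsdef]
  congr 3
  ring

/-! ### The recursion -/

section BaseMatrix

variable {nR nC : ℕ} (W : Matrix (Fin nR) (Fin nC) ℝ) (σ rate : ℝ)

lemma asympPsi_nonneg (t : ℕ) (c : Fin nC) : 0 ≤ asympPsi W σ rate t c := by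
  cases t with
  | zero => simp [asympPsi]
  | succ t =>
    simp only [asympPsi]
    split_ifs <;> norm_num

variable {W σ rate}

lemma asympPhi_pos (hσ : 0 < σ) (hW : ∀ r c, 0 ≤ W r c) (t : ℕ) (r : Fin nR) :
    0 < asympPhi W σ rate t r := by
  have : 0 ≤ 1 / (nC : ℝ) * ∑ c, W r c * asympPsi W σ rate t c :=
    mul_nonneg (by positivity)
      (Finset.sum_nonneg fun c _ => mul_nonneg (hW r c) (asympPsi_nonneg W σ rate t c))
  unfold asympPhi rowVar
  positivity

lemma colSnr_pos {φ : Fin nR → ℝ} (hW : ∀ r c, 0 ≤ W r c) (hφ : ∀ r, 0 < φ r) {c : Fin nC}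
    (hc : 0 < 1 / (nR : ℝ) * ∑ r, W r c) : 0 < colSnr W φ c := by
  have hn : 0 < 1 / (nR : ℝ) := pos_of_mul_pos_left hc (Finset.sum_nonneg fun r _ => hW r c)
  refine mul_pos hn ?_
  obtain ⟨r, -, hr⟩ := Finset.exists_ne_zero_of_sum_ne_zero (pos_of_mul_pos_right hc hn.le).ne'
  exact Finset.sum_pos' (fun r _ => div_nonneg (hW r c) (hφ r).le)
    ⟨r, Finset.mem_univ r, div_pos ((hW r c).lt_of_ne' hr) (hφ r)⟩

lemma tendsto_rowVar {ψ : ℕ → Fin nC → ℝ} {ψ₀ : Fin nC → ℝ}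
    (h : ∀ c, Tendsto (fun M => ψ M c) atTop (𝓝 (ψ₀ c))) (r : Fin nR) :
    Tendsto (fun M => rowVar W σ (ψ M) r) atTop (𝓝 (rowVar W σ ψ₀ r)) :=
  ((tendsto_finsetSum _ fun c _ => (h c).const_mul _).const_mul _).const_add _

lemma tendsto_colSnr {φ : ℕ → Fin nR → ℝ} {φ₀ : Fin nR → ℝ}
    (h : ∀ r, Tendsto (fun M => φ M r) atTop (𝓝 (φ₀ r))) (h₀ : ∀ r, 0 < φ₀ r) (c : Fin nC) :
    Tendsto (fun M => colSnr W (φ M) c) atTop (𝓝 (colSnr W φ₀ c)) :=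
  (tendsto_finsetSum _ fun r _ => tendsto_const_nhds.div (h r) (h₀ r).ne').const_mul _

/-- The threshold phenomenon in one step of the recursion: `τ ln (K M)` tends to
`rate / (2 S)` with `S` the limiting value of `colSnr`, and the threshold `1 / 2` for this limit
is the threshold `rate` for `S`. -/
lemma tendsto_one_sub_seE {K : ℕ} (hK : 1 ≤ K) (hrate : 0 < rate) {φ : ℕ → Fin nR → ℝ} {S : ℝ}
    {c : Fin nC} (hφ : Tendsto (fun M => colSnr W (φ M) c) atTop (𝓝 S)) (hS : 0 < S)
    (hne : S ≠ rate) :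
    Tendsto (fun M => 1 - seE K M (effNoise W rate K M (φ M) c)) atTop
      (𝓝 (1 - if S > rate then 1 else 0)) := by
  have hlog : Tendsto (fun M : ℕ => Real.log ((K : ℝ) * M)) atTop atTop :=
    Real.tendsto_log_atTop.comp
      (tendsto_natCast_atTop_atTop.const_mul_atTop (by exact_mod_cast hK))
  have hinv := hφ.inv₀ hS.ne'
  have hpos : ∀ᶠ M in atTop, 0 < effNoise W rate K M (φ M) c := by
    filter_upwards [hlog.eventually_gt_atTop 0, hφ.eventually_const_lt hS] with M h1 h2
    unfold effNoise
    positivity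
  have h0 : Tendsto (fun M => effNoise W rate K M (φ M) c) atTop (𝓝 0) := by
    simpa [effNoise] using (hlog.const_div_atTop (rate / 2)).mul hinv
  have hκ : Tendsto (fun M : ℕ => effNoise W rate K M (φ M) c * Real.log ((K : ℝ) * M)) atTop
      (𝓝 (rate / 2 * S⁻¹)) := by
    refine (hinv.const_mul (rate / 2)).congr' ?_
    filter_upwards [hlog.eventually_gt_atTop 0] with M h1
    unfold effNoise
    field_simp
  refine Tendsto.const_sub 1 ?_
  split_ifs with h
  · refine tendsto_seE_one hK hpos h0 hκ ?_
    rw [← div_eq_mul_inv, div_lt_iff₀ hS]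
    linarith
  · refine tendsto_seE_zero hK hpos h0 hκ ?_
    have := lt_of_le_of_ne (not_lt.1 h) hne
    rw [← div_eq_mul_inv, lt_div_iff₀ hS]
    linarith

end BaseMatrix

end ModSparc

theorem corollary1 {nR nC : ℕ} (W : Matrix (Fin nR) (Fin nC) ℝ) (σ rate ξ₁ ξ₂ : ℝ) (K : ℕ)
    (hσ : 0 < σ) (hrate : 0 < rate) (hK : 1 ≤ K)
    (hW : ∀ r c, 0 ≤ W r c)
    (hξ₁ : 0 < ξ₁) (hξ₂ : 0 < ξ₂)
    (hcol : ∀ c, ξ₁ ≤ 1 / (nR : ℝ) * ∑ r, W r c ∧ 1 / (nR : ℝ) * ∑ r, W r c ≤ ξ₂)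
    (hrow : ∀ r, ξ₁ ≤ 1 / (nC : ℝ) * ∑ c, W r c ∧ 1 / (nC : ℝ) * ∑ c, W r c ≤ ξ₂)
    (t : ℕ)
    -- no column block is exactly at the threshold in an iteration before `t`
    (hcrit : ∀ s < t, ∀ c, ModSparc.colSnr W (ModSparc.asympPhi W σ rate s) c ≠ rate) :
    (∀ c, Tendsto (fun M : ℕ => ModSparc.sePsi W σ rate K M t c) atTop
      (𝓝 (ModSparc.asympPsi W σ rate t c))) ∧
    (∀ r, Tendsto (fun M : ℕ => ModSparc.sePhi W σ rate K M t r) atTop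
      (𝓝 (ModSparc.asympPhi W σ rate t r))) ∧
    (∀ c, ModSparc.colSnr W (ModSparc.asympPhi W σ rate t) c ≠ rate →
      Tendsto (fun M : ℕ => ModSparc.sePsi W σ rate K M (t + 1) c) atTop
        (𝓝 (ModSparc.asympPsi W σ rate (t + 1) c))) := by

  have hstep (s : ℕ) (hs : ∀ c, Tendsto (fun M : ℕ => ModSparc.sePsi W σ rate K M s c) atTop
      (𝓝 (ModSparc.asympPsi W σ rate s c))) (c : Fin nC)
      (hc : ModSparc.colSnr W (ModSparc.asympPhi W σ rate s) c ≠ rate) :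
      Tendsto (fun M : ℕ => ModSparc.sePsi W σ rate K M (s + 1) c) atTop
        (𝓝 (ModSparc.asympPsi W σ rate (s + 1) c)) :=
    have hφ := ModSparc.asympPhi_pos (rate := rate) hσ hW s
    ModSparc.tendsto_one_sub_seE hK hrate
      (ModSparc.tendsto_colSnr (fun r => ModSparc.tendsto_rowVar hs r) hφ c)
      (ModSparc.colSnr_pos hW hφ (hξ₁.trans_le (hcol c).1)) hc
  have hψ (s : ℕ) (hst : s ≤ t) (c : Fin nC) :
      Tendsto (fun M : ℕ => ModSparc.sePsi W σ rate K M s c) atTop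
        (𝓝 (ModSparc.asympPsi W σ rate s c)) := by
    induction s generalizing c with
    | zero => exact tendsto_const_nhds
    | succ s ih => exact hstep s (fun c => ih (by lia) c) c (hcrit s (by lia) c)
  exact ⟨hψ t le_rfl, fun r => ModSparc.tendsto_rowVar (hψ t le_rfl) r,
    hstep t (hψ t le_rfl)⟩
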